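/- Fix $\omega\in(0,\infty)$. Let $\sigma_1=\begin{bmatrix}0&1\\1&0\end{bmatrix}$, $\sigma_3=\begin{bmatrix}1&0\\0&-1\end{bmatrix}$, and for $x,\xi\in\mathbb R$ set $$\Psi_{1,\omega}(x,\xi)=\frac1{\sqrt{2\pi}}\frac{(\xi+i\sqrt\omega\tanh(\sqrt\omega x))^2}{(|\xi|-i\sqrt\omega)^2}e^{ix\xi},\qquad \Psi_{2,\omega}(x,\xi)=\frac1{\sqrt{2\pi}}\frac{(\sqrt\omega\,\mathrm{sech}(\sqrt\omega x))^2}{(|\xi|-i\sqrt\omega)^2}e^{ix\xi},$$ $$\Psi_{+,\omega}=\begin{bmatrix}\Psi_{1,\omega}\\ \Psi_{2,\omega}\end{bmatrix},\qquad \Psi_{-,\omega}=\sigma_1\Psi_{+,\omega}=\begin{bmatrix}\Psi_{2,\omega}\\ \Psi_{1,\omega}\end{bmatrix}.$$ For $U,V\colon\mathbb R\to\mathbb C^2$ write $\langle U,V\rangle=\int_{\mathbb R}(u_1\bar v_1+u_2\bar v_2)\,dx$. Then, in the sense of (tempered) distributions in $(\xi,\eta)\in\mathbb R^2$, $$\langle\Psi_{+,\omega}(\cdot,\xi),\sigma_3\Psi_{+,\omega}(\cdot,\eta)\rangle=\delta_0(\xi-\eta),\qquad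 \langle\Psi_{-,\omega}(\cdot,\xi),\sigma_3\Psi_{-,\omega}(\cdot,\eta)\rangle=-\delta_0(\xi-\eta),$$ $$\langle\Psi_{+,\omega}(\cdot,\xi),\sigma_3\Psi_{-,\omega}(\cdot,\eta)\rangle=0,\qquad \langle\Psi_{-,\omega}(\cdot,\xi),\sigma_3\Psi_{+,\omega}(\cdot,\eta)\rangle=0.$$ Here $\langle U(\cdot,\xi),V(\cdot,\eta)\rangle=T$ in the sense of distributions means that for every Schwartz function $\varphi\in\mathcal S(\mathbb R^2)$ $$\int_{\mathbb R}\Big(\iint_{\mathbb R^2}\varphi(\xi,\eta)\big(U_1(x,\xi)\overline{V_1(x,\eta)}+U_2(x,\xi)\overline{V_2(x,\eta)}\big)\,d\xi\,d\eta\Big)dx=T(\varphi),$$ where the inner integral (for every $x$) and the outer integral converge absolutely, and $\delta_0(\xi-\eta)$ is the distribution $\varphi\mapsto\int_{\mathbb R}\varphi(\xi,\xi)\,d\xi$. -/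

import Mathlib

open scoped SchwartzMap Matrix

noncomputable section

/-- The Pauli matrix `σ₁`. -/
def pauli1 : Matrix (Fin 2) (Fin 2) ℂ := !![0, 1; 1, 0]

/-- The Pauli matrix `σ₃`. -/
def pauli3 : Matrix (Fin 2) (Fin 2) ℂ := !![1, 0; 0, -1]

/-- The real hyperbolic secant. -/
def sech (x : ℝ) : ℝ := 1 / Real.cosh x

/-- First component `Ψ_{1,ω}(x, ξ)` of the distorted Fourier basis. -/
def psi1 (ω x ξ : ℝ) : ℂ :=
  1 / (√(2 * Real.pi) : ℂ) *
    (((ξ : ℂ) + Complex.I * √ω * Real.tanh (√ω * x)) ^ 2 / ((|ξ| : ℝ) - Complex.I * √ω) ^ 2) *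
    Complex.exp (Complex.I * x * ξ)

/-- Second component `Ψ_{2,ω}(x, ξ)` of the distorted Fourier basis. -/
def psi2 (ω x ξ : ℝ) : ℂ :=
  1 / (√(2 * Real.pi) : ℂ) *
    (((√ω : ℂ) * sech (√ω * x)) ^ 2 / ((|ξ| : ℝ) - Complex.I * √ω) ^ 2) *
    Complex.exp (Complex.I * x * ξ)

/-- The basis function `Ψ_{+,ω}(x, ξ) ∈ ℂ²`. -/
def psiPlus (ω x ξ : ℝ) : Fin 2 → ℂ := ![psi1 ω x ξ, psi2 ω x ξ]

/-- The basis function `Ψ_{-,ω}(x, ξ) = σ₁ Ψ_{+,ω}(x, ξ) ∈ ℂ²`. -/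
def psiMinus (ω x ξ : ℝ) : Fin 2 → ℂ := pauli1 *ᵥ psiPlus ω x ξ

/-- The integrand `u₁ v̄₁ + u₂ v̄₂` of the inner product `⟨U, V⟩ = ∫ (u₁ v̄₁ + u₂ v̄₂) dx`
of two functions `ℝ → ℂ²`. -/
def innerDensity (u v : Fin 2 → ℂ) : ℂ := u 0 * star (v 0) + u 1 * star (v 1)

/-- For families `U(·, ξ)`, `V(·, η)` of functions `ℝ → ℂ²` and a tempered distribution `T`
in `(ξ, η) ∈ ℝ²`, the identity
`⟨U(·, ξ), V(·, η)⟩ = ∫ (U₁(x, ξ) V̄₁(x, η) + U₂(x, ξ) V̄₂(x, η)) dx = T(ξ, η)`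
in the sense of distributions: the oscillatory integral in `x` is taken after testing the
integrand against an arbitrary Schwartz function `φ(ξ, η)`. The integrals that occur are required
to converge absolutely. -/
def PairingEqDistribution (U V : ℝ → ℝ → Fin 2 → ℂ) (T : 𝓢'(ℝ × ℝ, ℂ)) : Prop :=
  ∀ φ : 𝓢(ℝ × ℝ, ℂ),
    (∀ x : ℝ, MeasureTheory.Integrable
      (fun p : ℝ × ℝ => φ p * innerDensity (U x p.1) (V x p.2))) ∧
    MeasureTheory.Integrable
      (fun x : ℝ => ∫ p : ℝ × ℝ, φ p * innerDensity (U x p.1) (V x p.2)) ∧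
    ∫ x : ℝ, ∫ p : ℝ × ℝ, φ p * innerDensity (U x p.1) (V x p.2) = T φ

/-- Restriction `φ ↦ (ξ ↦ φ(ξ, ξ))` of Schwartz functions on `ℝ²` to the diagonal. -/
def diagRestrict : 𝓢(ℝ × ℝ, ℂ) →L[ℂ] 𝓢(ℝ, ℂ) :=
  SchwartzMap.compCLMOfAntilipschitz ℂ (K := 1) (g := fun ξ : ℝ => (ξ, ξ))
    ((ContinuousLinearMap.id ℝ ℝ).prod (ContinuousLinearMap.id ℝ ℝ)).hasTemperateGrowth
    (fun x y => by simp [Prod.edist_eq])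

/-- The tempered distribution `δ₀(ξ - η)` on `ℝ²`, i.e. `φ ↦ ∫ φ(ξ, ξ) dξ`. -/
def deltaDiag : 𝓢'(ℝ × ℝ, ℂ) :=
  ContinuousLinearMap.toPointwiseConvergenceCLM ℂ (RingHom.id ℂ) 𝓢(ℝ × ℝ, ℂ) ℂ
    ((SchwartzMap.integralCLM ℂ (MeasureTheory.volume : MeasureTheory.Measure ℝ)).comp
      diagRestrict)

theorem deltaDiag_apply (φ : 𝓢(ℝ × ℝ, ℂ)) : deltaDiag φ = ∫ ξ : ℝ, φ (ξ, ξ) := rfl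

end

/-!
Put `M(x) = a tanh (a x)` with `a = √ω`, so that `M' = a² - M²`, and let `D = i (ξ - η)`,
`K = ξ η + a²`, `p(ξ) = (|ξ| - i a)⁻²`, `q(η) = (|η| + i a)⁻²` and `W = p(ξ) q(η) e^{x D}`. From
`(ξ + i M) (η - i M) = K - (M' + M D)` one finds that `2π` times the `(+, +)` density is
`K² W + ∂ₓ ((D M² - 2 K M) W)`, and that `2π` times the `(+, -)` density is the total derivative
`-i (ξ + η) ∂ₓ (M' W)`. Although `p` and `q` have a kink at `0`, one integration by parts in each
frequency shows that `W` tested against a Schwartz function is `O(x⁻²)`, so the derivatives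
integrate to `0`. By Fourier inversion the remaining term yields `K² p q` on the diagonal `ξ = η`,
where this weight is `1`.
-/

open MeasureTheory Filter Topology
open Complex (I exp)
open scoped FourierTransform LineDeriv

noncomputable section

theorem integral_eq_zero_of_hasDerivAt_off_point {E : Type*} [NormedAddCommGroup E]
    [NormedSpace ℝ E] [CompleteSpace E] {f f' : ℝ → E} {c : ℝ} (hcont : ContinuousAt f c)
    (hderiv : ∀ t ≠ c, HasDerivAt f (f' t) t) (hf' : Integrable f') (hf : Integrable f) :
    ∫ t, f' t = 0 := by
  have hbot : Tendsto f atBot (𝓝 0) :=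
    tendsto_zero_of_hasDerivAt_of_integrableOn_Iic (a := c - 1)
      (fun t ht => hderiv t (by grind)) hf'.integrableOn hf.integrableOn
  have htop : Tendsto f atTop (𝓝 0) :=
    tendsto_zero_of_hasDerivAt_of_integrableOn_Ioi (a := c)
      (fun t ht => hderiv t ht.ne') hf'.integrableOn hf.integrableOn
  rw [← intervalIntegral.integral_Iic_add_Ioi hf'.integrableOn hf'.integrableOn,
    integral_Iic_of_hasDerivAt_of_tendsto hcont.continuousWithinAt
      (fun t ht => hderiv t ht.ne) hf'.integrableOn hbot,
    integral_Ioi_of_hasDerivAt_of_tendsto hcont.continuousWithinAt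
      (fun t ht => hderiv t ht.ne') hf'.integrableOn htop]
  simp

/-- The logarithmic derivative `i (ξ - η)` in `x` of the plane wave `e^{i x (ξ - η)}`, at
`z = (ξ, η)`. -/
def freqDiff (z : ℝ × ℝ) : ℂ := I * (z.1 - z.2)

/-- The oscillatory integral `∬ G(ξ, η) e^{i x (ξ - η)} dξ dη`, as a function of `x`. -/
def oscIntegral (G : ℝ × ℝ → ℂ) (x : ℝ) : ℂ := ∫ z, G z * exp (x * freqDiff z)

@[fun_prop]
theorem hasTemperateGrowth_ofReal_fst :
    Function.HasTemperateGrowth fun z : ℝ × ℝ => (z.1 : ℂ) :=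
  (Complex.ofRealCLM.comp (ContinuousLinearMap.fst ℝ ℝ ℝ)).hasTemperateGrowth

@[fun_prop]
theorem hasTemperateGrowth_ofReal_snd :
    Function.HasTemperateGrowth fun z : ℝ × ℝ => (z.2 : ℂ) :=
  (Complex.ofRealCLM.comp (ContinuousLinearMap.snd ℝ ℝ ℝ)).hasTemperateGrowth

@[fun_prop]
theorem continuous_freqDiff : Continuous freqDiff := by
  unfold freqDiff
  fun_prop

@[fun_prop]
theorem hasTemperateGrowth_freqDiff : freqDiff.HasTemperateGrowth :=
  (Function.HasTemperateGrowth.const I).mul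
    (hasTemperateGrowth_ofReal_fst.sub hasTemperateGrowth_ofReal_snd)

theorem hasDerivAt_freqDiff_fst (t s : ℝ) : HasDerivAt (fun t => freqDiff (t, s)) I t := by
  simpa [freqDiff] using
    ((Complex.ofRealCLM.hasDerivAt (x := t)).sub_const (s : ℂ)).const_mul I

theorem norm_exp_mul_freqDiff (x : ℝ) (z : ℝ × ℝ) : ‖exp (x * freqDiff z)‖ = 1 := by
  simp [Complex.norm_exp, freqDiff]

section OscillatoryIntegral

variable {G : ℝ × ℝ → ℂ}

theorem integrable_mul_exp_freqDiff (hG : Integrable G) (x : ℝ) :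
    Integrable (fun z => G z * exp (x * freqDiff z)) :=
  hG.mul_bdd (c := 1) (Continuous.aestronglyMeasurable (by fun_prop))
    (.of_forall fun z => (norm_exp_mul_freqDiff x z).le)

theorem norm_oscIntegral_le (G : ℝ × ℝ → ℂ) (x : ℝ) : ‖oscIntegral G x‖ ≤ ∫ z, ‖G z‖ := by
  simpa [oscIntegral, norm_exp_mul_freqDiff] using
    norm_integral_le_integral_norm (μ := volume) fun z => G z * exp (x * freqDiff z)

theorem continuous_oscIntegral (hG : Integrable G) : Continuous (oscIntegral G) := by
  refine continuous_of_dominated (bound := fun z => ‖G z‖)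
    (fun x => (integrable_mul_exp_freqDiff hG x).aestronglyMeasurable)
    (fun x => .of_forall fun z => ?_) hG.norm (.of_forall fun z => by fun_prop)
  rw [norm_mul, norm_exp_mul_freqDiff, mul_one]

theorem oscIntegral_swap (G : ℝ × ℝ → ℂ) (x : ℝ) :
    oscIntegral (fun z => G z.swap) x = oscIntegral G (-x) := by
  rw [oscIntegral, oscIntegral, Measure.volume_eq_prod, ← integral_prod_swap]
  congr! 4
  simp only [freqDiff, Prod.fst_swap, Prod.snd_swap, Complex.ofReal_neg, neg_mul]
  ring

theorem hasDerivAt_oscIntegral (hG : Integrable G)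
    (hDG : Integrable fun z => freqDiff z * G z) (x : ℝ) :
    HasDerivAt (oscIntegral G) (oscIntegral (fun z => freqDiff z * G z) x) x := by
  refine (hasDerivAt_integral_of_dominated_loc_of_deriv_le (μ := volume) (s := Set.univ)
    (F := fun (y : ℝ) z => G z * exp (y * freqDiff z))
    (F' := fun (y : ℝ) z => freqDiff z * G z * exp (y * freqDiff z))
    (bound := fun z => ‖freqDiff z * G z‖) univ_mem
    (.of_forall fun y => (integrable_mul_exp_freqDiff hG y).aestronglyMeasurable)
    (integrable_mul_exp_freqDiff hG x) (integrable_mul_exp_freqDiff hDG x).aestronglyMeasurable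
    (.of_forall fun z y _ => ?_) hDG.norm (.of_forall fun z y _ => ?_)).2
  · rw [norm_mul, norm_exp_mul_freqDiff, mul_one]
  · have hphase : HasDerivAt (fun y : ℝ => exp (y * freqDiff z))
        (exp (y * freqDiff z) * (1 * freqDiff z)) y :=
      ((Complex.ofRealCLM.hasDerivAt (x := y)).mul_const _).cexp
    convert! hphase.const_mul (G z) using 1
    ring

theorem oscIntegral_of_hasDerivAt_fst {G₁ : ℝ × ℝ → ℂ} {c : ℝ}
    (hcont : ∀ s, ContinuousAt (fun t => G (t, s)) c)
    (hderiv : ∀ t s, t ≠ c → HasDerivAt (fun t => G (t, s)) (G₁ (t, s)) t)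
    (hG : Integrable G) (hG₁ : Integrable G₁) (x : ℝ) :
    oscIntegral G₁ x = -(I * x) * oscIntegral G x := by
  have hE := integrable_mul_exp_freqDiff hG x
  have hE₁ := integrable_mul_exp_freqDiff hG₁ x
  have hsum : Integrable fun z => G₁ z * exp (x * freqDiff z) +
      I * x * (G z * exp (x * freqDiff z)) := hE₁.add (hE.const_mul _)
  have hsplit : ∫ z, (G₁ z * exp (x * freqDiff z) + I * x * (G z * exp (x * freqDiff z))) =
      oscIntegral G₁ x + I * x * oscIntegral G x :=
    (integral_add hE₁ (hE.const_mul _)).trans (by rw [integral_const_mul]; rfl)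
  suffices h : ∫ z, (G₁ z * exp (x * freqDiff z) + I * x * (G z * exp (x * freqDiff z))) = 0 by
    linear_combination hsplit.symm.trans h
  rw [Measure.volume_eq_prod] at hE hsum ⊢
  rw [integral_prod_symm _ hsum]
  refine integral_eq_zero_of_ae ?_
  filter_upwards [hE.prod_left_ae, hsum.prod_left_ae] with s hs hs'
  refine integral_eq_zero_of_hasDerivAt_off_point (c := c) ?_ (fun t ht => ?_) hs' hs
  · exact (hcont s).mul (Continuous.continuousAt (by fun_prop))
  · convert! (hderiv t s ht).mul ((hasDerivAt_freqDiff_fst t s).const_mul (x : ℂ)).cexp using 1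
    ring

theorem oscIntegral_of_hasDerivAt_snd {G₂ : ℝ × ℝ → ℂ} {c : ℝ}
    (hcont : ∀ t, ContinuousAt (fun s => G (t, s)) c)
    (hderiv : ∀ t s, s ≠ c → HasDerivAt (fun s => G (t, s)) (G₂ (t, s)) s)
    (hG : Integrable G) (hG₂ : Integrable G₂) (x : ℝ) :
    oscIntegral G₂ x = I * x * oscIntegral G x := by
  have h := oscIntegral_of_hasDerivAt_fst (G := fun z => G z.swap) (G₁ := fun z => G₂ z.swap)
    hcont (fun t s => hderiv s t) hG.swap hG₂.swap (-x)
  rw [oscIntegral_swap, oscIntegral_swap, neg_neg] at h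
  rw [h]
  push_cast
  ring

theorem integrable_oscIntegral_of_mixed_deriv {G₁ G₁₂ : ℝ × ℝ → ℂ} {b c : ℝ}
    (hG : Integrable G) (hG₁ : Integrable G₁) (hG₁₂ : Integrable G₁₂)
    (hcont : ∀ s, ContinuousAt (fun t => G (t, s)) b)
    (hderiv : ∀ t s, t ≠ b → HasDerivAt (fun t => G (t, s)) (G₁ (t, s)) t)
    (hcont₁ : ∀ t, ContinuousAt (fun s => G₁ (t, s)) c)
    (hderiv₁ : ∀ t s, s ≠ c → HasDerivAt (fun s => G₁ (t, s)) (G₁₂ (t, s)) s) :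
    Integrable (oscIntegral G) := by
  refine (integrable_inv_one_add_sq.const_mul ((∫ z, ‖G z‖) + ∫ z, ‖G₁₂ z‖)).mono'
    (continuous_oscIntegral hG).aestronglyMeasurable (.of_forall fun x => ?_)
  have hsq : oscIntegral G₁₂ x = (x ^ 2 : ℝ) * oscIntegral G x := by
    rw [oscIntegral_of_hasDerivAt_snd hcont₁ hderiv₁ hG₁ hG₁₂,
      oscIntegral_of_hasDerivAt_fst hcont hderiv hG hG₁]
    push_cast
    linear_combination -(x ^ 2 * oscIntegral G x) * Complex.I_sq
  rw [← div_eq_mul_inv, le_div_iff₀ (by positivity)]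
  calc ‖oscIntegral G x‖ * (1 + x ^ 2) = ‖oscIntegral G x‖ + ‖oscIntegral G₁₂ x‖ := by
        rw [hsq, norm_mul, Complex.norm_real, Real.norm_of_nonneg (sq_nonneg x)]
        ring
    _ ≤ _ := add_le_add (norm_oscIntegral_le G x) (norm_oscIntegral_le G₁₂ x)

theorem integrable_shear (hG : Integrable G) :
    Integrable (fun z : ℝ × ℝ => G (z.1 + z.2, z.2)) :=
  (measurePreserving_add_prod volume volume).integrable_comp_of_integrable hG

theorem oscIntegral_eq_fourier (hG : Integrable G) (x : ℝ) :
    oscIntegral G x = 𝓕 (fun t => ∫ s, G (t + s, s)) (-(2 * Real.pi)⁻¹ * x) := by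
  have hE := integrable_mul_exp_freqDiff hG x
  have hmp := measurePreserving_add_prod (volume : Measure ℝ) (volume : Measure ℝ)
  have hshear := integrable_shear hE
  rw [oscIntegral, Real.fourier_real_eq_integral_exp_smul]
  rw [Measure.volume_eq_prod] at hE hshear ⊢
  nth_rewrite 1 [← hmp.map_eq]
  rw [integral_map hmp.aemeasurable (by rw [hmp.map_eq]; exact hE.aestronglyMeasurable),
    integral_prod _ hshear]
  refine integral_congr_ae (.of_forall fun t => ?_)
  dsimp only
  rw [smul_eq_mul, ← integral_const_mul]
  refine integral_congr_ae (.of_forall fun s => ?_)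
  dsimp only
  have hphase : ((-2 * Real.pi * t * (-(2 * Real.pi)⁻¹ * x) : ℝ) : ℂ) * I =
      x * freqDiff (t + s, s) := by
    have : -2 * Real.pi * t * (-(2 * Real.pi)⁻¹ * x) = t * x := by field_simp
    rw [this, freqDiff]
    push_cast
    ring
  rw [hphase, mul_comm]

theorem integral_oscIntegral (hG : Integrable G) (hint : Integrable (oscIntegral G))
    (hcont : ContinuousAt (fun t => ∫ s, G (t + s, s)) 0) :
    ∫ x, oscIntegral G x = 2 * Real.pi * ∫ s, G (s, s) := by
  set F : ℝ → ℂ := fun t => ∫ s, G (t + s, s) with hF_def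
  have hfourier : oscIntegral G = fun x => 𝓕 F (-(2 * Real.pi)⁻¹ * x) :=
    funext (oscIntegral_eq_fourier hG)
  have hF : Integrable F := by
    have := integrable_shear hG
    rw [Measure.volume_eq_prod] at this
    exact this.integral_prod_left
  have hFF : Integrable (𝓕 F) := by
    rwa [hfourier, integrable_comp_mul_left_iff _ (by simp [Real.pi_ne_zero])] at hint
  have hinv : ∫ ξ, 𝓕 F ξ = F 0 := by
    simpa [Real.fourierInv_eq'] using hF.fourierInv_fourier_eq hFF hcont
  rw [hfourier, Measure.integral_comp_mul_left, hinv]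
  simp [hF_def, abs_of_pos Real.pi_pos]

end OscillatoryIntegral

/-- A measurable bounded function `p : ℝ → ℂ`: a weight in one frequency variable. -/
structure IsBoundedWeight (p : ℝ → ℂ) : Prop where
  measurable : Measurable p
  bounded : ∃ C, ∀ t, ‖p t‖ ≤ C

/-- A bounded Lipschitz weight that is differentiable away from `0`, where it may have a kink, as
functions of `|ξ|` do. -/
structure IsKinkWeight (p : ℝ → ℂ) : Prop where
  bounded : ∃ C, ∀ t, ‖p t‖ ≤ C
  lipschitz : ∃ K, LipschitzWith K p
  differentiableAt : ∀ t ≠ 0, DifferentiableAt ℝ p t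

namespace IsKinkWeight

variable {p : ℝ → ℂ}

theorem continuous (hp : IsKinkWeight p) : Continuous p :=
  hp.lipschitz.choose_spec.continuous

theorem isBoundedWeight (hp : IsKinkWeight p) : IsBoundedWeight p :=
  ⟨hp.continuous.measurable, hp.bounded⟩

theorem isBoundedWeight_deriv (hp : IsKinkWeight p) : IsBoundedWeight (deriv p) :=
  ⟨measurable_deriv p, _, fun _ => norm_deriv_le_of_lipschitz hp.lipschitz.choose_spec⟩

end IsKinkWeight

/-- The test function `φ` with one bounded weight attached to each frequency variable. -/
def weightedTest (p q : ℝ → ℂ) (φ : 𝓢(ℝ × ℝ, ℂ)) (z : ℝ × ℝ) : ℂ := φ z * (p z.1 * q z.2)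

section WeightedTest

variable {p q : ℝ → ℂ}

theorem integrable_weightedTest (hp : IsBoundedWeight p) (hq : IsBoundedWeight q)
    (φ : 𝓢(ℝ × ℝ, ℂ)) : Integrable (weightedTest p q φ) := by
  obtain ⟨C, hC⟩ := hp.bounded
  obtain ⟨D, hD⟩ := hq.bounded
  refine φ.integrable.mul_bdd (c := C * D) ?_ (.of_forall fun z => ?_)
  · exact ((hp.measurable.comp measurable_fst).mul
      (hq.measurable.comp measurable_snd)).aestronglyMeasurable
  · exact norm_mul_le_of_le (hC _) (hD _)

theorem hasDerivAt_schwartz_fst (φ : 𝓢(ℝ × ℝ, ℂ)) (t s : ℝ) :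
    HasDerivAt (fun t => φ (t, s)) ((∂_{((1, 0) : ℝ × ℝ)} φ) (t, s)) t :=
  φ.differentiableAt.hasFDerivAt.comp_hasDerivAt t
    ((hasDerivAt_id t).prodMk (hasDerivAt_const t s))

theorem hasDerivAt_schwartz_snd (φ : 𝓢(ℝ × ℝ, ℂ)) (t s : ℝ) :
    HasDerivAt (fun s => φ (t, s)) ((∂_{((0, 1) : ℝ × ℝ)} φ) (t, s)) s :=
  φ.differentiableAt.hasFDerivAt.comp_hasDerivAt s
    ((hasDerivAt_const s t).prodMk (hasDerivAt_id s))

theorem hasDerivAt_weightedTest_fst {t : ℝ} (hp : DifferentiableAt ℝ p t) (q : ℝ → ℂ)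
    (φ : 𝓢(ℝ × ℝ, ℂ)) (s : ℝ) :
    HasDerivAt (fun t => weightedTest p q φ (t, s))
      (weightedTest p q (∂_{((1, 0) : ℝ × ℝ)} φ) (t, s) + weightedTest (deriv p) q φ (t, s)) t :=
  (hasDerivAt_schwartz_fst φ t s).mul (hp.hasDerivAt.mul_const (q s))

theorem hasDerivAt_weightedTest_snd {s : ℝ} (hq : DifferentiableAt ℝ q s) (p : ℝ → ℂ)
    (φ : 𝓢(ℝ × ℝ, ℂ)) (t : ℝ) :
    HasDerivAt (fun s => weightedTest p q φ (t, s))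
      (weightedTest p q (∂_{((0, 1) : ℝ × ℝ)} φ) (t, s) + weightedTest p (deriv q) φ (t, s)) s :=
  (hasDerivAt_schwartz_snd φ t s).mul (hq.hasDerivAt.const_mul (p t))

theorem integrable_oscIntegral_weightedTest (hp : IsKinkWeight p) (hq : IsKinkWeight q)
    (φ : 𝓢(ℝ × ℝ, ℂ)) : Integrable (oscIntegral (weightedTest p q φ)) := by
  have hpb := hp.isBoundedWeight
  have hqb := hq.isBoundedWeight
  have hpd := hp.isBoundedWeight_deriv
  have hqd := hq.isBoundedWeight_deriv
  have hpc := hp.continuous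
  have hqc := hq.continuous
  have hcont_snd (p : ℝ → ℂ) (ψ : 𝓢(ℝ × ℝ, ℂ)) (t : ℝ) :
      Continuous fun s => weightedTest p q ψ (t, s) :=
    (ψ.continuous.comp (.prodMk_right t)).mul (hqc.const_mul (p t))
  refine integrable_oscIntegral_of_mixed_deriv (b := 0) (c := 0)
    (integrable_weightedTest hpb hqb φ)
    ((integrable_weightedTest hpb hqb _).add (integrable_weightedTest hpd hqb φ))
    (((integrable_weightedTest hpb hqb _).add (integrable_weightedTest hpb hqd _)).add
      ((integrable_weightedTest hpd hqb _).add (integrable_weightedTest hpd hqd φ)))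
    (fun s => ((φ.continuous.comp (.prodMk_left s)).mul (hpc.mul_const (q s))).continuousAt)
    (fun t s ht => hasDerivAt_weightedTest_fst (hp.differentiableAt t ht) q φ s)
    (fun t => ((hcont_snd p _ t).add (hcont_snd (deriv p) φ t)).continuousAt)
    (fun t s hs => (hasDerivAt_weightedTest_snd (hq.differentiableAt s hs) p _ t).add
      (hasDerivAt_weightedTest_snd (hq.differentiableAt s hs) (deriv p) φ t))

theorem exists_norm_schwartz_le_inv_one_add_sq_snd (φ : 𝓢(ℝ × ℝ, ℂ)) :
    ∃ C, ∀ z, ‖φ z‖ ≤ C * (1 + z.2 ^ 2)⁻¹ := by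
  refine ⟨2 ^ 2 * (Finset.Iic (2, 0)).sup (fun m => SchwartzMap.seminorm ℂ m.1 m.2) φ, fun z => ?_⟩
  rw [← div_eq_mul_inv, le_div_iff₀ (by positivity), mul_comm]
  refine le_trans ?_ (SchwartzMap.one_add_le_sup_seminorm_apply (𝕜 := ℂ) (m := (2, 0)) (k := 2)
    (n := 0) le_rfl le_rfl φ z)
  rw [norm_iteratedFDeriv_zero]
  gcongr
  have hz : |z.2| ≤ ‖z‖ := norm_snd_le z
  nlinarith [sq_abs z.2, abs_nonneg z.2]

theorem continuous_integral_weightedTest_shear (hp : IsKinkWeight p) (hq : IsKinkWeight q)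
    (φ : 𝓢(ℝ × ℝ, ℂ)) : Continuous fun t => ∫ s, weightedTest p q φ (t + s, s) := by
  obtain ⟨C, hC⟩ := hp.bounded
  obtain ⟨D, hD⟩ := hq.bounded
  obtain ⟨A, hA⟩ := exists_norm_schwartz_le_inv_one_add_sq_snd φ
  have hpc := hp.continuous
  have hqc := hq.continuous
  have hφ := φ.continuous
  unfold weightedTest
  exact continuous_of_dominated (bound := fun s => A * (1 + s ^ 2)⁻¹ * (C * D))
    (fun t => Continuous.aestronglyMeasurable (by fun_prop))
    (fun t => .of_forall fun s =>
      norm_mul_le_of_le (hA (t + s, s)) (norm_mul_le_of_le (hC _) (hD _)))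
    ((integrable_inv_one_add_sq.const_mul _).mul_const _) (.of_forall fun s => by fun_prop)

theorem integral_oscIntegral_weightedTest (hp : IsKinkWeight p) (hq : IsKinkWeight q)
    (φ : 𝓢(ℝ × ℝ, ℂ)) :
    ∫ x, oscIntegral (weightedTest p q φ) x = 2 * Real.pi * ∫ s, φ (s, s) * (p s * q s) :=
  integral_oscIntegral (integrable_weightedTest hp.isBoundedWeight hq.isBoundedWeight φ)
    (integrable_oscIntegral_weightedTest hp hq φ)
    (continuous_integral_weightedTest_shear hp hq φ).continuousAt

theorem hasDerivAt_oscIntegral_weightedTest (hp : IsBoundedWeight p) (hq : IsBoundedWeight q)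
    (φ : 𝓢(ℝ × ℝ, ℂ)) (x : ℝ) :
    HasDerivAt (oscIntegral (weightedTest p q φ))
      (oscIntegral (weightedTest p q (SchwartzMap.smulLeftCLM ℂ freqDiff φ)) x) x := by
  have h : weightedTest p q (SchwartzMap.smulLeftCLM ℂ freqDiff φ) =
      fun z => freqDiff z * weightedTest p q φ z := by
    ext z
    simp only [weightedTest, SchwartzMap.smulLeftCLM_apply_apply hasTemperateGrowth_freqDiff,
      smul_eq_mul, mul_assoc]
  rw [h]
  exact hasDerivAt_oscIntegral (integrable_weightedTest hp hq φ)
    (h ▸ integrable_weightedTest hp hq _) x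

end WeightedTest

/-- The function kernel `k x (ξ, η)`, integrated over `x` after testing against `φ(ξ, η)`,
represents the functional `T`; the integrals that occur converge absolutely. This is
`PairingEqDistribution` for kernels that need not come from a pairing. -/
def RepresentsFunctional (k : ℝ → ℝ × ℝ → ℂ) (T : 𝓢(ℝ × ℝ, ℂ) → ℂ) : Prop :=
  ∀ φ : 𝓢(ℝ × ℝ, ℂ),
    (∀ x, Integrable fun z => φ z * k x z) ∧
    Integrable (fun x => ∫ z, φ z * k x z) ∧
    ∫ x, ∫ z, φ z * k x z = T φ

namespace RepresentsFunctional

variable {k k₁ k₂ : ℝ → ℝ × ℝ → ℂ} {T T₁ T₂ : 𝓢(ℝ × ℝ, ℂ) → ℂ}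

theorem add (h₁ : RepresentsFunctional k₁ T₁) (h₂ : RepresentsFunctional k₂ T₂) :
    RepresentsFunctional (k₁ + k₂) (T₁ + T₂) := by
  intro φ
  obtain ⟨hz₁, hx₁, hT₁⟩ := h₁ φ
  obtain ⟨hz₂, hx₂, hT₂⟩ := h₂ φ
  have hsum (x : ℝ) : ∫ z, φ z * (k₁ + k₂) x z = (∫ z, φ z * k₁ x z) + ∫ z, φ z * k₂ x z := by
    simp only [Pi.add_apply, mul_add]
    exact integral_add (hz₁ x) (hz₂ x)
  simp only [hsum]
  refine ⟨fun x => ?_, hx₁.add hx₂, ?_⟩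
  · simp only [Pi.add_apply, mul_add]
    exact (hz₁ x).add (hz₂ x)
  · rw [integral_add hx₁ hx₂, hT₁, hT₂, Pi.add_apply]

theorem temperate_mul (h : RepresentsFunctional k T) {m : ℝ × ℝ → ℂ} (hm : m.HasTemperateGrowth) :
    RepresentsFunctional (fun x z => m z * k x z)
      (fun φ => T (SchwartzMap.smulLeftCLM ℂ m φ)) := by
  intro φ
  simpa only [SchwartzMap.smulLeftCLM_apply_apply hm, smul_eq_mul, mul_assoc, mul_left_comm]
    using h (SchwartzMap.smulLeftCLM ℂ m φ)

end RepresentsFunctional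

/-- The weighted plane-wave kernel `p(ξ) q(η) e^{i x (ξ - η)}`. -/
def oscKernel (p q : ℝ → ℂ) (x : ℝ) (z : ℝ × ℝ) : ℂ := p z.1 * q z.2 * exp (x * freqDiff z)

section OscKernel

variable {p q : ℝ → ℂ}

theorem mul_oscKernel (p q : ℝ → ℂ) (φ : 𝓢(ℝ × ℝ, ℂ)) (x : ℝ) (z : ℝ × ℝ) :
    φ z * oscKernel p q x z = weightedTest p q φ z * exp (x * freqDiff z) :=
  (mul_assoc _ _ _).symm

theorem representsFunctional_oscKernel (hp : IsKinkWeight p) (hq : IsKinkWeight q) :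
    RepresentsFunctional (oscKernel p q)
      (fun φ => 2 * Real.pi * ∫ s, φ (s, s) * (p s * q s)) := by
  intro φ
  simp only [mul_oscKernel]
  exact ⟨integrable_mul_exp_freqDiff
      (integrable_weightedTest hp.isBoundedWeight hq.isBoundedWeight φ),
    integrable_oscIntegral_weightedTest hp hq φ, integral_oscIntegral_weightedTest hp hq φ⟩

theorem integrable_and_integral_totalDeriv_oscKernel (hp : IsBoundedWeight p)
    (hq : IsBoundedWeight q) (c c' : ℂ) (φ : 𝓢(ℝ × ℝ, ℂ)) (x : ℝ) :
    Integrable (fun z => φ z * ((c' + c * freqDiff z) * oscKernel p q x z)) ∧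
    ∫ z, φ z * ((c' + c * freqDiff z) * oscKernel p q x z) =
      c' * oscIntegral (weightedTest p q φ) x +
        c * oscIntegral (weightedTest p q (SchwartzMap.smulLeftCLM ℂ freqDiff φ)) x := by
  set Dφ := SchwartzMap.smulLeftCLM ℂ freqDiff φ with hDφ
  have hsplit (z : ℝ × ℝ) : φ z * ((c' + c * freqDiff z) * oscKernel p q x z) =
      c' * (weightedTest p q φ z * exp (x * freqDiff z)) +
        c * (weightedTest p q Dφ z * exp (x * freqDiff z)) := by
    rw [← mul_oscKernel, ← mul_oscKernel, hDφ,
      SchwartzMap.smulLeftCLM_apply_apply hasTemperateGrowth_freqDiff, smul_eq_mul]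
    ring
  have hint (ψ : 𝓢(ℝ × ℝ, ℂ)) := integrable_mul_exp_freqDiff (integrable_weightedTest hp hq ψ) x
  simp only [hsplit]
  refine ⟨((hint φ).const_mul c').add ((hint Dφ).const_mul c), ?_⟩
  rw [integral_add ((hint φ).const_mul c') ((hint Dφ).const_mul c), integral_const_mul,
    integral_const_mul]
  rfl

/-- The kernel is `∂ₓ (u(x) p(ξ) q(η) e^{i x (ξ - η)})`. -/
theorem representsFunctional_zero_of_hasDerivAt (hp : IsKinkWeight p) (hq : IsKinkWeight q)
    {u u' : ℝ → ℂ} (hu : ∀ x, HasDerivAt u (u' x) x) (hub : ∃ C, ∀ x, ‖u x‖ ≤ C)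
    (hub' : ∃ C, ∀ x, ‖u' x‖ ≤ C) :
    RepresentsFunctional (fun x z => (u' x + u x * freqDiff z) * oscKernel p q x z) 0 := by
  intro φ
  obtain ⟨C, hC⟩ := hub
  obtain ⟨C', hC'⟩ := hub'
  have hpb := hp.isBoundedWeight
  have hqb := hq.isBoundedWeight
  have hum : Measurable u :=
    (continuous_iff_continuousAt.2 fun x => (hu x).continuousAt).measurable
  have hum' : Measurable u' := (funext fun x => (hu x).deriv) ▸ measurable_deriv u
  have hf := integrable_oscIntegral_weightedTest hp hq φ
  have hf' := integrable_oscIntegral_weightedTest hp hq (SchwartzMap.smulLeftCLM ℂ freqDiff φ)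
  have hderiv := (hf.bdd_mul hum'.aestronglyMeasurable (.of_forall hC')).add
    (hf'.bdd_mul hum.aestronglyMeasurable (.of_forall hC))
  have hkernel (x : ℝ) :=
    integrable_and_integral_totalDeriv_oscKernel hpb hqb (u x) (u' x) φ x
  simp only [(hkernel _).2]
  exact ⟨fun x => (hkernel x).1, hderiv, integral_eq_zero_of_hasDerivAt_of_integrable
    (fun x => (hu x).mul (hasDerivAt_oscIntegral_weightedTest hpb hqb φ x)) hderiv
    (hf.bdd_mul hum.aestronglyMeasurable (.of_forall hC))⟩

end OscKernel

theorem IsKinkWeight.of_comp_abs {g : ℝ → ℂ} {C : ℝ} {K : NNReal} (hb : ∀ r, ‖g r‖ ≤ C)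
    (hl : LipschitzWith K g) (hd : Differentiable ℝ g) : IsKinkWeight fun t => g |t| where
  bounded := ⟨C, fun t => hb |t|⟩
  lipschitz := ⟨_, hl.comp lipschitzWith_one_norm⟩
  differentiableAt t ht := hd.differentiableAt.comp t (differentiableAt_abs ht)

/-- The weight `1 / (|ξ| - i a)²` occurring in the distorted Fourier basis with `a = √ω`. -/
def resolventWeight (a t : ℝ) : ℂ := (((|t| : ℝ) - I * a) ^ 2)⁻¹

theorem abs_le_norm_ofReal_sub_I_mul (r a : ℝ) : |a| ≤ ‖(r : ℂ) - I * a‖ := by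
  simpa using Complex.abs_im_le_norm ((r : ℂ) - I * a)

theorem isKinkWeight_resolventWeight {a : ℝ} (ha : a ≠ 0) : IsKinkWeight (resolventWeight a) := by
  have ha' : 0 < |a| := abs_pos.2 ha
  have hle := abs_le_norm_ofReal_sub_I_mul (a := a)
  have hne (r : ℝ) : (r : ℂ) - I * a ≠ 0 := norm_pos_iff.1 (ha'.trans_le (hle r))
  have hderiv (r : ℝ) : HasDerivAt (fun r : ℝ => (((r : ℂ) - I * a) ^ 2)⁻¹)
      (-2 / ((r : ℂ) - I * a) ^ 3) r := by
    convert! (((Complex.ofRealCLM.hasDerivAt (x := r)).sub_const (I * a)).pow 2).inv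
      (pow_ne_zero 2 (hne r)) using 1
    have := hne r
    simp only [Nat.cast_ofNat, Complex.ofRealCLM_apply, Nat.add_one_sub_one, pow_one,
      Complex.ofReal_one, mul_one, Pi.pow_apply]
    field_simp
  refine .of_comp_abs (g := fun r : ℝ => (((r : ℂ) - I * a) ^ 2)⁻¹) (C := (|a| ^ 2)⁻¹)
    (K := (2 / |a| ^ 3).toNNReal) (fun r => ?_)
    (lipschitzWith_of_nnnorm_deriv_le (fun r => (hderiv r).differentiableAt) fun r => ?_)
    (fun r => (hderiv r).differentiableAt)
  · rw [norm_inv, norm_pow]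
    gcongr
    exact hle r
  · refine NNReal.le_toNNReal_of_coe_le ?_
    rw [coe_nnnorm, (hderiv r).deriv, norm_div, norm_neg, norm_pow, RCLike.norm_ofNat]
    gcongr
    exact hle r

theorem sq_mul_resolventWeight_mul_resolventWeight_neg {a : ℝ} (ha : a ≠ 0) (t : ℝ) :
    ((t * t + a ^ 2 : ℂ) ^ 2) * (resolventWeight a t * resolventWeight (-a) t) = 1 := by
  have hne : (t * t + a ^ 2 : ℂ) ≠ 0 := by
    have : 0 < t * t + a ^ 2 := add_pos_of_nonneg_of_pos (mul_self_nonneg t) (by positivity)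
    exact_mod_cast this.ne'
  have habs : ((|t| : ℝ) : ℂ) ^ 2 = t * t := by exact_mod_cast (sq_abs t).trans (sq t)
  have hnorm : ((|t| : ℝ) - I * a) * ((|t| : ℝ) - I * (-a : ℝ)) = (t * t + a ^ 2 : ℂ) := by
    push_cast
    linear_combination habs - (a : ℂ) ^ 2 * Complex.I_sq
  rw [resolventWeight, resolventWeight, ← mul_inv, ← mul_pow, hnorm,
    mul_inv_cancel₀ (pow_ne_zero 2 hne)]

theorem star_resolventWeight (a t : ℝ) :
    star (resolventWeight a t) = resolventWeight (-a) t := by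
  simp [resolventWeight, ← starRingEnd_apply]

/-- The profile `M(x) = a tanh (a x)`, which solves the Riccati equation `M' = a² - M²`. -/
def kinkProfile (a x : ℝ) : ℝ := a * Real.tanh (a * x)

theorem hasDerivAt_kinkProfile (a x : ℝ) :
    HasDerivAt (kinkProfile a) (a ^ 2 - kinkProfile a x ^ 2) x := by
  have hc := (Real.cosh_pos (a * x)).ne'
  have h : HasDerivAt (fun x => a * x) a x := by simpa using (hasDerivAt_id x).const_mul a
  have hdiv := (h.sinh.div h.cosh hc).const_mul a
  unfold kinkProfile
  simp only [Real.tanh_eq_sinh_div_cosh]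
  convert! hdiv using 1
  field_simp

theorem abs_kinkProfile_le (a x : ℝ) : |kinkProfile a x| ≤ |a| := by
  rw [kinkProfile, abs_mul]
  exact mul_le_of_le_one_right (abs_nonneg a) (Real.abs_tanh_lt_one _).le

theorem sq_mul_sech_eq (a x : ℝ) : (a * sech (a * x)) ^ 2 = a ^ 2 - kinkProfile a x ^ 2 := by
  have hc := (Real.cosh_pos (a * x)).ne'
  rw [sech, kinkProfile, Real.tanh_eq_sinh_div_cosh]
  field_simp
  linear_combination -a ^ 2 * Real.cosh_sq (a * x)

theorem representsFunctional_zero_of_kinkProfile {p q : ℝ → ℂ} (hp : IsKinkWeight p)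
    (hq : IsKinkWeight q) (a : ℝ) {g g' : ℂ → ℂ} (hg : ∀ w, HasDerivAt g (g' w) w)
    (hg' : Continuous g') :
    RepresentsFunctional (fun x z => (g' (kinkProfile a x) * (a ^ 2 - kinkProfile a x ^ 2) +
      g (kinkProfile a x) * freqDiff z) * oscKernel p q x z) 0 := by
  have hbdd {h : ℂ → ℂ} (hh : Continuous h) : ∃ C, ∀ x, ‖h (kinkProfile a x)‖ ≤ C := by
    obtain ⟨C, hC⟩ :=
      (isCompact_closedBall (0 : ℂ) |a|).exists_bound_of_continuousOn hh.continuousOn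
    exact ⟨C, fun x => hC _ (by simpa using abs_kinkProfile_le a x)⟩
  refine representsFunctional_zero_of_hasDerivAt hp hq (fun x => ?_)
    (hbdd (continuous_iff_continuousAt.2 fun w => (hg w).continuousAt))
    (hbdd (h := fun w => g' w * (a ^ 2 - w ^ 2)) (by fun_prop))
  have h := (hg (kinkProfile a x)).comp x (hasDerivAt_kinkProfile a x).ofReal_comp
  push_cast at h
  exact h

/-- The common factor `(2π)^{-1/2} e^{i x ξ} / (|ξ| - i√ω)²` of `psi1` and `psi2`. -/
def resolventWave (ω x ξ : ℝ) : ℂ :=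
  1 / (√(2 * Real.pi) : ℂ) * (resolventWeight √ω ξ * exp (I * x * ξ))

theorem psi1_eq (ω x ξ : ℝ) :
    psi1 ω x ξ = (ξ + I * kinkProfile √ω x) ^ 2 * resolventWave ω x ξ := by
  rw [psi1, resolventWave, resolventWeight, kinkProfile]
  push_cast
  ring

theorem psi2_eq (ω x ξ : ℝ) :
    psi2 ω x ξ = ((√ω : ℝ) ^ 2 - kinkProfile √ω x ^ 2) * resolventWave ω x ξ := by
  have h := congrArg (fun y : ℝ => (y : ℂ)) (sq_mul_sech_eq √ω x)
  push_cast at h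
  rw [← h, psi2, resolventWave, resolventWeight]
  ring

theorem star_psi1 (ω x ξ : ℝ) :
    star (psi1 ω x ξ) = (ξ - I * kinkProfile √ω x) ^ 2 * star (resolventWave ω x ξ) := by
  rw [psi1_eq, star_mul']
  simp [← starRingEnd_apply, ← sub_eq_add_neg]

theorem star_psi2 (ω x ξ : ℝ) :
    star (psi2 ω x ξ) = ((√ω : ℝ) ^ 2 - kinkProfile √ω x ^ 2) * star (resolventWave ω x ξ) := by
  rw [psi2_eq, star_mul']
  simp [← starRingEnd_apply]

theorem resolventWave_mul_star (ω x : ℝ) (z : ℝ × ℝ) :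
    resolventWave ω x z.1 * star (resolventWave ω x z.2) =
      (2 * Real.pi : ℂ)⁻¹ * oscKernel (resolventWeight √ω) (resolventWeight (-√ω)) x z := by
  have hnorm : (1 / (√(2 * Real.pi) : ℂ)) * star (1 / (√(2 * Real.pi) : ℂ)) =
      (2 * Real.pi : ℂ)⁻¹ := by
    have hreal : star (1 / (√(2 * Real.pi) : ℂ)) = 1 / (√(2 * Real.pi) : ℂ) := by
      simp [← starRingEnd_apply]
    rw [hreal, ← sq, div_pow, ← Complex.ofReal_pow, Real.sq_sqrt (by positivity)]
    simp
  have hexp : exp (I * x * z.1) * star (exp (I * x * z.2)) = exp (x * freqDiff z) := by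
    rw [← starRingEnd_apply, ← Complex.exp_conj, ← Complex.exp_add, freqDiff]
    congr 1
    simp only [map_mul, Complex.conj_I, Complex.conj_ofReal, neg_mul]
    ring
  rw [resolventWave, resolventWave, star_mul', star_mul', star_resolventWeight, oscKernel, ← hnorm,
    ← hexp]
  ring

theorem innerDensity_plus_plus (ω x : ℝ) (z : ℝ × ℝ) :
    innerDensity (psiPlus ω x z.1) (pauli3 *ᵥ psiPlus ω x z.2) = (2 * Real.pi : ℂ)⁻¹ *
      (((z.1 + I * kinkProfile √ω x) * (z.2 - I * kinkProfile √ω x)) ^ 2 -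
        ((√ω : ℝ) ^ 2 - kinkProfile √ω x ^ 2) ^ 2) *
      oscKernel (resolventWeight √ω) (resolventWeight (-√ω)) x z := by
  have h : innerDensity (psiPlus ω x z.1) (pauli3 *ᵥ psiPlus ω x z.2) =
      psi1 ω x z.1 * star (psi1 ω x z.2) - psi2 ω x z.1 * star (psi2 ω x z.2) := by
    simp [innerDensity, psiPlus, pauli3, Matrix.mulVec, dotProduct, sub_eq_add_neg]
  rw [h, star_psi1, star_psi2, psi1_eq, psi2_eq]
  linear_combination (((z.1 + I * kinkProfile √ω x) * (z.2 - I * kinkProfile √ω x)) ^ 2 -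
    ((√ω : ℝ) ^ 2 - kinkProfile √ω x ^ 2) ^ 2) *
    resolventWave_mul_star ω x z

theorem innerDensity_plus_minus (ω x : ℝ) (z : ℝ × ℝ) :
    innerDensity (psiPlus ω x z.1) (pauli3 *ᵥ psiMinus ω x z.2) = (2 * Real.pi : ℂ)⁻¹ *
      (((√ω : ℝ) ^ 2 - kinkProfile √ω x ^ 2) *
        ((z.1 + I * kinkProfile √ω x) ^ 2 - (z.2 - I * kinkProfile √ω x) ^ 2)) *
      oscKernel (resolventWeight √ω) (resolventWeight (-√ω)) x z := by
  have h : innerDensity (psiPlus ω x z.1) (pauli3 *ᵥ psiMinus ω x z.2) =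
      psi1 ω x z.1 * star (psi2 ω x z.2) - psi2 ω x z.1 * star (psi1 ω x z.2) := by
    simp [innerDensity, psiPlus, psiMinus, pauli3, pauli1, Matrix.mulVec, dotProduct,
      sub_eq_add_neg]
  rw [h, star_psi1, star_psi2, psi1_eq, psi2_eq]
  linear_combination (((√ω : ℝ) ^ 2 - kinkProfile √ω x ^ 2) *
        ((z.1 + I * kinkProfile √ω x) ^ 2 - (z.2 - I * kinkProfile √ω x) ^ 2)) *
    resolventWave_mul_star ω x z

theorem RepresentsFunctional.pairingEqDistribution {k : ℝ → ℝ × ℝ → ℂ} {T : 𝓢(ℝ × ℝ, ℂ) → ℂ}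
    {U V : ℝ → ℝ → Fin 2 → ℂ} {S : 𝓢'(ℝ × ℝ, ℂ)} (h : RepresentsFunctional k T)
    (hk : ∀ x z, innerDensity (U x z.1) (V x z.2) = k x z) (hT : ∀ φ, T φ = S φ) :
    PairingEqDistribution U V S := by
  intro φ
  simpa only [hk, ← hT] using h φ

theorem PairingEqDistribution.neg {U V U' V' : ℝ → ℝ → Fin 2 → ℂ} {T : 𝓢'(ℝ × ℝ, ℂ)}
    (h : PairingEqDistribution U V T)
    (hneg : ∀ x ξ η, innerDensity (U' x ξ) (V' x η) = -innerDensity (U x ξ) (V x η)) :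
    PairingEqDistribution U' V' (-T) := by
  intro φ
  obtain ⟨hz, hx, hT⟩ := h φ
  simp only [hneg, mul_neg, integral_neg]
  exact ⟨fun x => (hz x).neg, hx.neg, congrArg Neg.neg hT⟩

theorem pairing_plus_plus {ω : ℝ} (hω : 0 < ω) :
    PairingEqDistribution (psiPlus ω) (fun x η => pauli3 *ᵥ psiPlus ω x η) deltaDiag := by
  have ha : √ω ≠ 0 := (Real.sqrt_pos.2 hω).ne'
  have hp := isKinkWeight_resolventWeight ha
  have hq := isKinkWeight_resolventWeight (neg_ne_zero.2 ha)
  have hsq : Function.HasTemperateGrowth fun z : ℝ × ℝ =>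
      (2 * Real.pi : ℂ)⁻¹ * (z.1 * z.2 + (√ω : ℝ) ^ 2) ^ 2 := by fun_prop
  have hlin : Function.HasTemperateGrowth fun z : ℝ × ℝ =>
      (2 * Real.pi : ℂ)⁻¹ * (-2 * (z.1 * z.2 + (√ω : ℝ) ^ 2)) := by fun_prop
  have hfreq : Function.HasTemperateGrowth fun z => (2 * Real.pi : ℂ)⁻¹ * freqDiff z := by
    fun_prop
  have hid := representsFunctional_zero_of_kinkProfile hp hq √ω hasDerivAt_id continuous_const
  have hpow := representsFunctional_zero_of_kinkProfile hp hq √ω (g := fun w => w ^ 2)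
    (g' := fun w => 2 * w) (fun w => by simpa using hasDerivAt_pow 2 w) (by fun_prop)
  refine ((((representsFunctional_oscKernel hp hq).temperate_mul hsq).add
    (hid.temperate_mul hlin)).add (hpow.temperate_mul hfreq)).pairingEqDistribution
    (fun x z => ?_) fun φ => ?_
  · have hfactor : (z.1 + I * kinkProfile √ω x) * (z.2 - I * kinkProfile √ω x) =
        (z.1 * z.2 + (√ω : ℝ) ^ 2 : ℂ) -
          ((√ω : ℝ) ^ 2 - kinkProfile √ω x ^ 2 + kinkProfile √ω x * freqDiff z) := by
      rw [freqDiff]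
      linear_combination -(kinkProfile √ω x : ℂ) ^ 2 * Complex.I_sq
    rw [innerDensity_plus_plus, hfactor]
    simp only [Pi.add_apply, id]
    ring
  · simp only [Pi.add_apply, Pi.zero_apply, add_zero, deltaDiag_apply, ← integral_const_mul,
      SchwartzMap.smulLeftCLM_apply_apply hsq, smul_eq_mul]
    refine integral_congr_ae (.of_forall fun s => ?_)
    have hpi : (2 * Real.pi : ℂ) * (2 * Real.pi : ℂ)⁻¹ = 1 :=
      mul_inv_cancel₀ (by simp [Real.pi_ne_zero])
    dsimp only
    linear_combination φ (s, s) * hpi +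
      2 * Real.pi * (2 * Real.pi : ℂ)⁻¹ * φ (s, s) *
        sq_mul_resolventWeight_mul_resolventWeight_neg ha s

theorem pairing_plus_minus {ω : ℝ} (hω : 0 < ω) :
    PairingEqDistribution (psiPlus ω) (fun x η => pauli3 *ᵥ psiMinus ω x η) 0 := by
  have ha : √ω ≠ 0 := (Real.sqrt_pos.2 hω).ne'
  have htotal := representsFunctional_zero_of_kinkProfile (isKinkWeight_resolventWeight ha)
    (isKinkWeight_resolventWeight (neg_ne_zero.2 ha)) √ω (g := fun w => (√ω : ℝ) ^ 2 - w ^ 2)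
    (g' := fun w => -(2 * w)) (fun w => by simpa using (hasDerivAt_pow 2 w).const_sub _)
    (by fun_prop)
  have hm : Function.HasTemperateGrowth
      fun z : ℝ × ℝ => (2 * Real.pi : ℂ)⁻¹ * (-I * (z.1 + z.2)) := by fun_prop
  refine (htotal.temperate_mul hm).pairingEqDistribution (fun x z => ?_) fun φ => rfl
  rw [innerDensity_plus_minus, freqDiff]
  linear_combination (2 * Real.pi : ℂ)⁻¹ * ((√ω : ℝ) ^ 2 - kinkProfile √ω x ^ 2) *
    (z.1 ^ 2 - z.2 ^ 2) * oscKernel (resolventWeight √ω) (resolventWeight (-√ω)) x z * Complex.I_sq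

theorem lemma3p7 (ω : ℝ) (hω : 0 < ω) :
    PairingEqDistribution (psiPlus ω) (fun x η => pauli3 *ᵥ psiPlus ω x η) deltaDiag ∧
    PairingEqDistribution (psiMinus ω) (fun x η => pauli3 *ᵥ psiMinus ω x η) (-deltaDiag) ∧
    PairingEqDistribution (psiPlus ω) (fun x η => pauli3 *ᵥ psiMinus ω x η) 0 ∧
    PairingEqDistribution (psiMinus ω) (fun x η => pauli3 *ᵥ psiPlus ω x η) 0 := by
  refine ⟨pairing_plus_plus hω, (pairing_plus_plus hω).neg fun x ξ η => ?_,
    pairing_plus_minus hω, ?_⟩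
  · simp [innerDensity, psiPlus, psiMinus, pauli3, pauli1, Matrix.mulVec, dotProduct]
  · rw [← neg_zero]
    refine (pairing_plus_minus hω).neg fun x ξ η => ?_
    simp [innerDensity, psiPlus, psiMinus, pauli3, pauli1, Matrix.mulVec, dotProduct, add_comm]

end
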